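/- Theorem 5. For $z,x\in\mathbb C^n$ let $\mathrm{dist}(z,x)=\min_{\theta\in[0,2\pi)}\|e^{i\theta}z-x\|_2$. Consider the observations $y_k=|\langle\varphi_k,x\rangle|^2+\xi_k$, $k=1,\dots,m$, of an unknown signal $x\in\mathbb C^n$, where the design vectors $\varphi_1,\dots,\varphi_m$ are i.i.d. $\mathcal{CN}(0,I_n)$ and the noise variables $\xi_1,\dots,\xi_m$ are i.i.d. $\mathcal N(0,\sigma^2)$, $\sigma>0$, independent of the design. Conditionally on the design $\varphi=(\varphi_k)_{k\le m}$, the minimax risk is $$R_{n,m,\sigma}(\varphi)=\inf_{\widehat x}\ \sup_{x\in\mathbb C^n}\ \mathbb E\big[\mathrm{dist}(\widehat x,x)\,\big|\,\varphi\big],$$ where the infimum is over all estimators, i.e. all measurable functions $\widehat x=\widehat x(y)$ of the data, which may be chosen with knowledge of $\varphi$ and $\sigma$. There are universal constants $L,C_1,C_2>0$ such that the following holds for all $n=n_j\to\infty$, $m=m_j\to\infty$ with $m\ge Ln$ for all large $j$, and all $\sigma=\sigma_j>0$. (a) With probability (over the design) tending to $1$, for every $x\in\mathbb C^n\setminus\{0\}$,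 $$R_{n,m,\sigma}(\varphi)\ \ge\ C_1\min\left\{\|x\|_2,\ \frac{\sqrt{n/m}}{\|x\|_2\sqrt{\log m}/\sigma+\left(\frac{\log m}{\sigma^2}\right)^{1/4}\left(\frac nm\right)^{1/4}}\right\}.$$ (b) For all $x=x_j\in\mathbb C^n$ that are nonzero for all large $j$ and satisfy $\|x\|_2=o\!\left(\sqrt\sigma\,\frac{(n/m)^{1/4}}{\log^{1/4}m}\right)$, with probability (over the design) tending to $1$, $$R_{n,m,\sigma}(\varphi)\ \ge\ C_2\,\sqrt\sigma\,\frac{(n/m)^{1/4}}{\log^{1/4}m}.$$ -/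

import Mathlib

open MeasureTheory ProbabilityTheory Filter Asymptotics
open scoped ENNReal Topology

noncomputable section

namespace PhaseRetrieval

/-- The Euclidean distance modulo a global phase on `ℂⁿ`:
`dist(z, x) = min_{θ ∈ [0, 2π)} ‖e^{iθ} z - x‖₂`
(the minimum is attained by compactness of the circle, so it equals the infimum). -/
def phaseDist {n : ℕ} (z x : EuclideanSpace ℂ (Fin n)) : ℝ :=
  ⨅ θ : Set.Ico (0 : ℝ) (2 * Real.pi), ‖Complex.exp (((θ : ℝ) : ℂ) * Complex.I) • z - x‖

/-- The phaseless measurements `(|⟨φ_k, x⟩|²)_k`. -/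
def phaseless {n m : ℕ} (φ : Fin m → EuclideanSpace ℂ (Fin n)) (x : EuclideanSpace ℂ (Fin n)) :
    Fin m → ℝ :=
  fun k => ‖inner ℂ (φ k) x‖ ^ 2

/-- The standard circular complex Gaussian law `CN(0, 1)` on `ℂ`: real and imaginary parts are
independent, each `N(0, 1/2)`. -/
def complexGaussian : Measure ℂ :=
  ((gaussianReal 0 (1 / 2)).prod (gaussianReal 0 (1 / 2))).map Complex.measurableEquivRealProd.symm

/-- The law `CN(0, I_n)` on `ℂⁿ`: the coordinates are i.i.d. `CN(0, 1)`. -/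
def complexGaussianVec (n : ℕ) : Measure (EuclideanSpace ℂ (Fin n)) :=
  (Measure.pi fun _ : Fin n => complexGaussian).map (WithLp.toLp 2)

/-- The joint law of `m` i.i.d. `CN(0, I_n)` design vectors. -/
def designLaw (n m : ℕ) : Measure (Fin m → EuclideanSpace ℂ (Fin n)) :=
  Measure.pi fun _ : Fin m => complexGaussianVec n

/-- The joint law of `m` i.i.d. `N(0, σ²)` noise variables. -/
def noiseLaw (m : ℕ) (σ : ℝ) : Measure (Fin m → ℝ) :=
  Measure.pi fun _ : Fin m => gaussianReal 0 (σ ^ 2).toNNReal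

/-- The risk `E[dist(x̂(y), x) | φ]` of the estimator `x̂` at the signal `x`, conditionally on the
design `φ`, where `y = (|⟨φ_k, x⟩|² + ξ_k)_k`. The noise is independent of the design, so its
conditional law is `noiseLaw m σ`. -/
def risk {n m : ℕ} (σ : ℝ) (φ : Fin m → EuclideanSpace ℂ (Fin n))
    (xhat : (Fin m → ℝ) → EuclideanSpace ℂ (Fin n)) (x : EuclideanSpace ℂ (Fin n)) : ℝ≥0∞ :=
  ∫⁻ ξ, ENNReal.ofReal (phaseDist (xhat (phaseless φ x + ξ)) x) ∂(noiseLaw m σ)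

/-- The minimax risk conditionally on the design `φ`: the infimum over all estimators (measurable
functions of the data `y`, chosen with knowledge of `φ` and `σ`) of the supremum over all signals
`x ∈ ℂⁿ` of the risk. -/
def minimaxRisk {n m : ℕ} (σ : ℝ) (φ : Fin m → EuclideanSpace ℂ (Fin n)) : ℝ≥0∞ :=
  ⨅ (xhat : (Fin m → ℝ) → EuclideanSpace ℂ (Fin n)) (_ : Measurable xhat),
    ⨆ x : EuclideanSpace ℂ (Fin n), risk σ φ xhat x

/-- The events `A j ⊆ Ω j` hold with probability approaching `1` as `j → ∞`. No measurability of
`A j` is presupposed: it is the outer probability of the failure of `A j` that tends to `0`. -/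
def WithProbTendstoOne {Ω : ℕ → Type*} [∀ j, MeasurableSpace (Ω j)] (P : ∀ j, Measure (Ω j))
    (A : ∀ j, Set (Ω j)) : Prop :=
  Tendsto (fun j => P j (A j)ᶜ) atTop (𝓝 0)

end PhaseRetrieval

end

namespace PhaseRetrieval

/-! ### Products of one-dimensional integrals -/

/-! The minimax risk involves no particular signal, so both parts reduce to a lower bound at the
critical radius δ = √σ (n/m)^{1/4} / log^{1/4} m, coming from signals so weak that the data are
nearly pure noise.

The hard family is the 2^n sign vectors `signVec δ ε` of norm δ. If an estimator had risk below δ/8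
at each of them, it would land within δ/2 of each with probability at least 3/4.
`noiseLaw_shift_sq_le` transfers these events to the law of the noise alone, at a cost exp(S_ε/σ²),
where S_ε is the sum of the fourth powers |⟨φ_k, x_ε⟩|⁴. But a single output can be within δ/2 of at
most a fraction 2 exp(-n/8) of the family, by Hoeffding (`card_phaseDist_signVec_lt_le`). If the
average of S_ε is at most nσ²/32, the two facts collide (`le_minimaxRisk_of_sum_le`).

The expected average of S_ε over the design is at most 400 m δ⁴, so Markov bounds the failure
probability by 12800 m δ⁴ / (nσ²) = 12800 / log m, which tends to 0. The logarithm in the rate is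
exactly this slack. -/

theorem lintegral_pi_prod {α : Type*} [MeasurableSpace α] {n : ℕ} (μ : Fin n → Measure α)
    [∀ i, SigmaFinite (μ i)] (f : Fin n → α → ℝ≥0∞) (hf : ∀ i, Measurable (f i)) :
    ∫⁻ x, ∏ i, f i (x i) ∂(Measure.pi μ) = ∏ i, ∫⁻ a, f i a ∂(μ i) := by
  induction n with
  | zero => simp
  | succ n ih =>
    have h := (measurePreserving_piFinSuccAbove μ 0).symm
    rw [← h.lintegral_comp_emb (MeasurableEquiv.measurableEmbedding _)]
    simp only [Fin.prod_univ_succ, MeasurableEquiv.piFinSuccAbove_symm_apply,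
      Fin.insertNthEquiv_apply, Fin.insertNth_zero', Fin.cons_zero, Fin.cons_succ]
    rw [lintegral_prod _ (by fun_prop)]
    simp only [Fin.zero_succAbove]
    have hm : Measurable fun y : Fin n → α => ∏ i : Fin n, f i.succ (y i) :=
      Finset.measurable_prod _ fun i _ => (hf _).comp (measurable_pi_apply i)
    simp_rw [lintegral_const_mul _ hm]
    rw [lintegral_mul_const _ (hf 0), ih (fun i => μ i.succ) (fun i => f i.succ) fun i => hf _]

theorem lintegral_exp_gaussianReal (v : NNReal) (t : ℝ) :
    ∫⁻ y, ENNReal.ofReal (Real.exp (t * y)) ∂(gaussianReal 0 v) =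
      ENNReal.ofReal (Real.exp (v * t ^ 2 / 2)) := by
  rw [← ofReal_integral_eq_lintegral_ofReal (integrable_exp_mul_gaussianReal t)
    (ae_of_all _ fun _ => (Real.exp_pos _).le)]
  have h := congrFun (mgf_fun_id_gaussianReal (μ := 0) (v := v)) t
  simp only [mgf, zero_mul, zero_add] at h
  rw [h]

/-! ### Change of measure for Gaussian shifts -/

/-- The likelihood ratio of `N(a, v)` with respect to `N(0, v)`. -/
noncomputable def shiftDensity (a v y : ℝ) : ℝ≥0∞ :=
  ENNReal.ofReal (Real.exp ((a * y - a ^ 2 / 2) / v))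

theorem measurable_shiftDensity (a v : ℝ) : Measurable (shiftDensity a v) := by
  unfold shiftDensity; fun_prop

theorem gaussianReal_eq_withDensity (a : ℝ) {v : NNReal} (hv : v ≠ 0) :
    gaussianReal a v = (gaussianReal 0 v).withDensity (shiftDensity a v) := by
  have hv' : (v : ℝ) ≠ 0 := by exact_mod_cast hv
  rw [gaussianReal_of_var_ne_zero _ hv, gaussianReal_of_var_ne_zero _ hv,
    ← withDensity_mul _ (measurable_gaussianPDF _ _) (measurable_shiftDensity _ _)]
  congr 1
  ext y
  simp only [Pi.mul_apply, gaussianPDF, shiftDensity, gaussianPDFReal]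
  rw [← ENNReal.ofReal_mul (by positivity), mul_assoc _ (Real.exp _) (Real.exp _), ← Real.exp_add]
  congr 3
  field_simp
  ring

/-- The squared likelihood ratio is a constant times an exponential of y, so the Gaussian moment
generating function evaluates it. This is the factor that Cauchy–Schwarz produces under a change of
measure. -/
theorem lintegral_shiftDensity_sq (a : ℝ) {v : NNReal} (hv : v ≠ 0) :
    ∫⁻ y, shiftDensity a v y ^ 2 ∂(gaussianReal 0 v) =
      ENNReal.ofReal (Real.exp (a ^ 2 / v)) := by
  have hv' : (v : ℝ) ≠ 0 := by exact_mod_cast hv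
  have h : ∀ y, shiftDensity a v y ^ 2 = ENNReal.ofReal (Real.exp (-(a ^ 2 / v))) *
      ENNReal.ofReal (Real.exp ((2 * a / v) * y)) := by
    intro y
    rw [shiftDensity, ← ENNReal.ofReal_pow (Real.exp_pos _).le, ← Real.exp_nat_mul,
      ← ENNReal.ofReal_mul (Real.exp_pos _).le, ← Real.exp_add]
    congr 2
    push_cast
    field_simp
    ring
  simp_rw [h]
  rw [lintegral_const_mul _ (by fun_prop), lintegral_exp_gaussianReal,
    ← ENNReal.ofReal_mul (Real.exp_pos _).le, ← Real.exp_add]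
  congr 2
  field_simp
  ring

theorem pi_gaussianReal_eq_withDensity {m : ℕ} (a : Fin m → ℝ) {v : NNReal} (hv : v ≠ 0) :
    Measure.pi (fun k => gaussianReal (a k) v) =
      (Measure.pi fun _ : Fin m => gaussianReal 0 v).withDensity
        (fun y => ∏ k, shiftDensity (a k) v (y k)) := by
  refine Measure.pi_eq fun s hs => ?_
  rw [withDensity_apply _ (MeasurableSet.univ_pi hs),
    ← lintegral_indicator (MeasurableSet.univ_pi hs)]
  have h : ∀ y : Fin m → ℝ, (Set.univ.pi s).indicator
      (fun y => ∏ k, shiftDensity (a k) v (y k)) y =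
        ∏ k, (s k).indicator (shiftDensity (a k) v) (y k) := by
    intro y
    by_cases hy : y ∈ Set.univ.pi s
    · rw [Set.indicator_of_mem hy]
      exact Finset.prod_congr rfl fun k _ => by rw [Set.indicator_of_mem (hy k trivial)]
    · rw [Set.indicator_of_notMem hy]
      simp only [Set.mem_pi, Set.mem_univ, true_imp_iff, not_forall] at hy
      obtain ⟨k, hk⟩ := hy
      exact (Finset.prod_eq_zero (Finset.mem_univ k) (Set.indicator_of_notMem hk _)).symm
  simp_rw [h]
  rw [lintegral_pi_prod _ (fun k => (s k).indicator (shiftDensity (a k) v))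
    fun k => (measurable_shiftDensity _ _).indicator (hs k)]
  refine Finset.prod_congr rfl fun k _ => ?_
  rw [lintegral_indicator (hs k), ← withDensity_apply _ (hs k), ← gaussianReal_eq_withDensity _ hv]

theorem map_add_noiseLaw {m : ℕ} (σ : ℝ) (a : Fin m → ℝ) :
    (noiseLaw m σ).map (fun ξ => a + ξ) =
      Measure.pi (fun k => gaussianReal (a k) (σ ^ 2).toNNReal) := by
  have h := Measure.pi_map_pi (μ := fun _ : Fin m => gaussianReal 0 (σ ^ 2).toNNReal)
    (f := fun k y => a k + y) fun k => by fun_prop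
  simp only [gaussianReal_map_const_add, zero_add] at h
  exact h

/-- Cameron–Martin with the Cauchy–Schwarz inequality: the probability of an event under a shift
of the Gaussian noise is controlled by its probability under the unshifted noise. -/
theorem noiseLaw_shift_sq_le {m : ℕ} {σ : ℝ} (hσ : 0 < σ) (a : Fin m → ℝ)
    {A : Set (Fin m → ℝ)} (hA : MeasurableSet A) :
    (noiseLaw m σ {ξ | a + ξ ∈ A}) ^ 2 ≤
      ENNReal.ofReal (Real.exp ((∑ k, a k ^ 2) / σ ^ 2)) * noiseLaw m σ A := by
  have hv : (σ ^ 2).toNNReal ≠ 0 := by simpa using hσ.ne'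
  have hvr : (((σ ^ 2).toNNReal : NNReal) : ℝ) = σ ^ 2 := Real.coe_toNNReal _ (sq_nonneg _)
  set L : (Fin m → ℝ) → ℝ≥0∞ := fun y => ∏ k, shiftDensity (a k) (σ ^ 2).toNNReal (y k) with hL
  have hLm : Measurable L :=
    Finset.measurable_prod _ fun k _ => (measurable_shiftDensity _ _).comp (measurable_pi_apply k)
  have h1 : noiseLaw m σ {ξ | a + ξ ∈ A} =
      ∫⁻ y, (L * (A.indicator 1 : (Fin m → ℝ) → ℝ≥0∞)) y ∂(noiseLaw m σ) := by
    have : {ξ | a + ξ ∈ A} = (fun ξ => a + ξ) ⁻¹' A := rfl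
    rw [this, ← Measure.map_apply (by fun_prop) hA, map_add_noiseLaw,
      pi_gaussianReal_eq_withDensity _ hv, withDensity_apply _ hA, ← lintegral_indicator hA]
    refine lintegral_congr fun y => ?_
    by_cases hy : y ∈ A <;> simp [hy, hL]
  have h2 : ∫⁻ y, L y ^ (2 : ℝ) ∂(noiseLaw m σ) =
      ENNReal.ofReal (Real.exp ((∑ k, a k ^ 2) / σ ^ 2)) := by
    simp_rw [ENNReal.rpow_two, hL, ← Finset.prod_pow]
    rw [noiseLaw, lintegral_pi_prod _ (fun k y => shiftDensity (a k) (σ ^ 2).toNNReal y ^ 2)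
      fun k => (measurable_shiftDensity _ _).pow_const 2]
    simp_rw [lintegral_shiftDensity_sq _ hv, hvr]
    rw [← ENNReal.ofReal_prod_of_nonneg fun _ _ => (Real.exp_pos _).le, ← Real.exp_sum,
      Finset.sum_div]
  have h3 : ∫⁻ y, (A.indicator 1 y : ℝ≥0∞) ^ (2 : ℝ) ∂(noiseLaw m σ) = noiseLaw m σ A := by
    rw [← lintegral_indicator_one hA]
    refine lintegral_congr fun y => ?_
    by_cases hy : y ∈ A <;> simp [hy]
  have h4 := ENNReal.lintegral_mul_le_Lp_mul_Lq (noiseLaw m σ)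
    (p := 2) (q := 2) (by constructor <;> norm_num) hLm.aemeasurable
    ((measurable_one.indicator hA).aemeasurable (f := A.indicator 1))
  rw [← h1, h2, h3] at h4
  calc _ ≤ _ := pow_le_pow_left' h4 2
    _ = _ := by
      rw [mul_pow, ← ENNReal.rpow_two, ← ENNReal.rpow_two, ← ENNReal.rpow_mul, ← ENNReal.rpow_mul]
      norm_num

/-! ### Fourth moments of the measurements -/

theorem lintegral_complexGaussian_exp (a b : ℝ) :
    ∫⁻ z, ENNReal.ofReal (Real.exp (a * z.re + b * z.im)) ∂complexGaussian =
      ENNReal.ofReal (Real.exp ((a ^ 2 + b ^ 2) / 4)) := by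
  rw [complexGaussian, MeasureTheory.lintegral_map_equiv]
  simp only [Complex.measurableEquivRealProd_symm_apply, Real.exp_add]
  simp_rw [ENNReal.ofReal_mul (Real.exp_pos _).le]
  rw [lintegral_prod_mul (f := fun y : ℝ => ENNReal.ofReal (Real.exp (a * y)))
    (g := fun y : ℝ => ENNReal.ofReal (Real.exp (b * y))) (by fun_prop) (by fun_prop),
    lintegral_exp_gaussianReal,
    lintegral_exp_gaussianReal, ← ENNReal.ofReal_mul (Real.exp_pos _).le, ← Real.exp_add]
  congr 2
  push_cast
  ring

instance : IsProbabilityMeasure complexGaussian :=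
  Measure.isProbabilityMeasure_map (MeasurableEquiv.measurable _).aemeasurable

instance (n : ℕ) : IsProbabilityMeasure (complexGaussianVec n) :=
  Measure.isProbabilityMeasure_map (by fun_prop)

instance (n m : ℕ) : IsProbabilityMeasure (designLaw n m) := by
  unfold designLaw; infer_instance

instance (m : ℕ) (σ : ℝ) : IsProbabilityMeasure (noiseLaw m σ) := by
  unfold noiseLaw; infer_instance

theorem lintegral_complexGaussianVec_exp {n : ℕ} (a b : Fin n → ℝ) :
    ∫⁻ φ, ENNReal.ofReal (Real.exp (∑ i, (a i * (φ i).re + b i * (φ i).im)))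
        ∂(complexGaussianVec n) =
      ENNReal.ofReal (Real.exp (∑ i, (a i ^ 2 + b i ^ 2) / 4)) := by
  rw [complexGaussianVec, lintegral_map (by fun_prop) (by fun_prop)]
  simp only [Real.exp_sum, ENNReal.ofReal_prod_of_nonneg fun _ _ => (Real.exp_pos _).le]
  rw [lintegral_pi_prod _
    (fun i (z : ℂ) => ENNReal.ofReal (Real.exp (a i * z.re + b i * z.im))) fun i => by fun_prop]
  simp_rw [lintegral_complexGaussian_exp]

theorem pow_four_le_exp (x : ℝ) : x ^ 4 ≤ 24 * (Real.exp x + Real.exp (-x)) := by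
  have key : ∀ y : ℝ, 0 ≤ y → y ^ 4 ≤ 24 * Real.exp y := by
    intro y hy
    have := Real.pow_div_factorial_le_exp y hy 4
    simp only [Nat.factorial] at this
    push_cast at this
    linarith
  rcases le_total 0 x with h | h
  · linarith [key x h, Real.exp_pos (-x)]
  · have := key (-x) (by linarith)
    rw [Even.neg_pow (by decide)] at this
    linarith [Real.exp_pos x]

/-- Exponential moments suffice: |w|⁴ ≤ 2(Re⁴ + Im⁴) and t⁴ ≤ 24(eᵗ + e⁻ᵗ) leave four exponentials
of linear forms, each with mean e^{1/4} ≤ 2. The total is 48 · 8 = 384. -/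
theorem lintegral_inner_pow_four_le_of_norm_one {n : ℕ} (x : EuclideanSpace ℂ (Fin n))
    (hx : ‖x‖ = 1) :
    ∫⁻ φ, ENNReal.ofReal (‖inner ℂ φ x‖ ^ 4) ∂(complexGaussianVec n) ≤ 400 := by
  have hre : ∀ φ : EuclideanSpace ℂ (Fin n), (inner ℂ φ x).re =
      ∑ i, ((x i).re * (φ i).re + (x i).im * (φ i).im) := by
    intro φ
    simp [PiLp.inner_apply, Complex.mul_re]
  have him : ∀ φ : EuclideanSpace ℂ (Fin n), (inner ℂ φ x).im =
      ∑ i, ((x i).im * (φ i).re + (-(x i).re) * (φ i).im) := by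
    intro φ
    simp [PiLp.inner_apply, Complex.mul_im]
    exact Finset.sum_congr rfl fun _ _ => by ring
  have hsum : ∑ i, ((x i).re ^ 2 + (x i).im ^ 2) / 4 = 1 / 4 := by
    rw [← Finset.sum_div]
    have := EuclideanSpace.norm_sq_eq x
    rw [hx] at this
    simp only [Complex.sq_norm, Complex.normSq_apply] at this
    rw [one_pow] at this
    rw [this]
    congr 1
    exact Finset.sum_congr rfl fun _ _ => by ring
  have hexp : Real.exp (1 / 4) ≤ 2 := by
    have : Real.exp (1 / 4) ≤ Real.exp (1 / 2) := Real.exp_le_exp.2 (by norm_num)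
    have h2 : Real.exp (1 / 2) ^ 2 = Real.exp 1 := by rw [← Real.exp_nat_mul]; norm_num
    nlinarith [Real.exp_one_lt_d9, Real.exp_pos (1 / 2 : ℝ)]
  have hE : ∀ a b : Fin n → ℝ, ∑ i, (a i ^ 2 + b i ^ 2) / 4 = 1 / 4 →
      ∫⁻ φ, ENNReal.ofReal (Real.exp (∑ i, (a i * (φ i).re + b i * (φ i).im)))
        ∂(complexGaussianVec n) ≤ 2 := by
    intro a b hab
    rw [lintegral_complexGaussianVec_exp, hab]
    exact ENNReal.ofReal_le_of_le_toReal (by simpa using hexp)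
  have hneg : ∀ (a b : Fin n → ℝ) (φ : EuclideanSpace ℂ (Fin n)),
      -∑ i, (a i * (φ i).re + b i * (φ i).im) =
        ∑ i, ((-a i) * (φ i).re + (-b i) * (φ i).im) := by
    intro a b φ
    rw [← Finset.sum_neg_distrib]
    exact Finset.sum_congr rfl fun _ _ => by ring
  have hpt : ∀ φ : EuclideanSpace ℂ (Fin n), ENNReal.ofReal (‖inner ℂ φ x‖ ^ 4) ≤
      48 * (ENNReal.ofReal (Real.exp (∑ i, ((x i).re * (φ i).re + (x i).im * (φ i).im)))
        + ENNReal.ofReal (Real.exp (∑ i, ((-(x i).re) * (φ i).re + (-(x i).im) * (φ i).im)))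
        + ENNReal.ofReal (Real.exp (∑ i, ((x i).im * (φ i).re + (-(x i).re) * (φ i).im)))
        + ENNReal.ofReal
          (Real.exp (∑ i, ((-(x i).im) * (φ i).re + (-(-(x i).re)) * (φ i).im)))) := by
    intro φ
    rw [← hneg (fun i => (x i).re) (fun i => (x i).im),
      ← hneg (fun i => (x i).im) (fun i => -(x i).re), ← hre, ← him]
    set w := inner ℂ φ x
    rw [← ENNReal.ofReal_add (by positivity) (by positivity),
      ← ENNReal.ofReal_add (by positivity) (by positivity),
      ← ENNReal.ofReal_add (by positivity) (by positivity),
      show (48 : ℝ≥0∞) = ENNReal.ofReal 48 by simp, ← ENNReal.ofReal_mul (by norm_num)]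
    refine ENNReal.ofReal_le_ofReal ?_
    have h1 : ‖w‖ ^ 4 = (w.re ^ 2 + w.im ^ 2) ^ 2 := by
      rw [show ‖w‖ ^ 4 = (‖w‖ ^ 2) ^ 2 by ring, Complex.sq_norm, Complex.normSq_apply]
      ring
    have h2 := pow_four_le_exp w.re
    have h3 := pow_four_le_exp w.im
    rw [h1]
    nlinarith [sq_nonneg (w.re ^ 2 - w.im ^ 2)]
  refine (lintegral_mono hpt).trans ?_
  rw [lintegral_const_mul _ (by fun_prop), lintegral_add_left (by fun_prop),
    lintegral_add_left (by fun_prop), lintegral_add_left (by fun_prop)]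
  calc _ ≤ (48 : ℝ≥0∞) * (2 + 2 + 2 + 2) := by
        gcongr
        · exact hE _ _ hsum
        · exact hE _ _ (by simpa using hsum)
        · exact hE _ _ (by rw [← hsum]; exact Finset.sum_congr rfl fun _ _ => by ring)
        · exact hE _ _ (by rw [← hsum]; exact Finset.sum_congr rfl fun _ _ => by ring)
    _ ≤ 400 := by norm_num

theorem lintegral_designLaw_eval {n m : ℕ} (k : Fin m) {f : EuclideanSpace ℂ (Fin n) → ℝ≥0∞}
    (hf : Measurable f) :
    ∫⁻ φ, f (φ k) ∂(designLaw n m) = ∫⁻ v, f v ∂(complexGaussianVec n) := by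
  have h := measurePreserving_eval (fun _ : Fin m => complexGaussianVec n) k
  exact h.lintegral_comp hf

/-! ### The distance modulo a global phase -/

theorem bddBelow_phaseDist {n : ℕ} (z x : EuclideanSpace ℂ (Fin n)) :
    BddBelow (Set.range fun θ : Set.Ico (0 : ℝ) (2 * Real.pi) =>
      ‖Complex.exp (((θ : ℝ) : ℂ) * Complex.I) • z - x‖) :=
  ⟨0, by rintro _ ⟨θ, rfl⟩; exact norm_nonneg _⟩

instance : Nonempty (Set.Ico (0 : ℝ) (2 * Real.pi)) := ⟨⟨0, le_rfl, by positivity⟩⟩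

theorem measurable_phaseDist {n : ℕ} (x : EuclideanSpace ℂ (Fin n)) :
    Measurable fun z => phaseDist z x := by
  -- Phases act by isometries, so the infimum of the distances is 1-Lipschitz in z.
  have h : LipschitzWith 1 fun z => phaseDist z x := by
    refine LipschitzWith.of_le_add fun z w => ?_
    rw [← sub_le_iff_le_add]
    refine le_ciInf fun θ => ?_
    rw [sub_le_iff_le_add]
    refine (ciInf_le (bddBelow_phaseDist z x) θ).trans ?_
    have : Complex.exp (((θ : ℝ) : ℂ) * Complex.I) • z - x =
        (Complex.exp (((θ : ℝ) : ℂ) * Complex.I) • w - x) +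
          Complex.exp (((θ : ℝ) : ℂ) * Complex.I) • (z - w) := by
      rw [smul_sub]; abel
    rw [this]
    refine (norm_add_le _ _).trans ?_
    rw [norm_smul (_ : ℂ) (z - w), Complex.norm_exp_ofReal_mul_I, one_mul, dist_eq_norm]
  exact h.continuous.measurable

theorem exists_norm_eq_one_of_phaseDist_lt {n : ℕ} {z x : EuclideanSpace ℂ (Fin n)} {r : ℝ}
    (h : phaseDist z x < r) : ∃ u : ℂ, ‖u‖ = 1 ∧ ‖u • z - x‖ < r := by
  obtain ⟨θ, hθ⟩ := exists_lt_of_ciInf_lt h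
  exact ⟨_, Complex.norm_exp_ofReal_mul_I _, hθ⟩

/-- Two vectors of norm `2 r` within phase distance `r` of a common point are far from
orthogonal. -/
theorem norm_inner_gt_of_phaseDist_lt {n : ℕ} {z x x' : EuclideanSpace ℂ (Fin n)} {r : ℝ}
    (h : phaseDist z x < r) (h' : phaseDist z x' < r) (hx : ‖x‖ = 2 * r) (hx' : ‖x'‖ = 2 * r) :
    2 * r ^ 2 < ‖inner ℂ x x'‖ := by
  obtain ⟨u, hu, hux⟩ := exists_norm_eq_one_of_phaseDist_lt h
  obtain ⟨v, hv, hvx⟩ := exists_norm_eq_one_of_phaseDist_lt h'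
  have h1 : ‖v • x - u • x'‖ < 2 * r := by
    -- Crossing the two phases makes the terms in z cancel.
    have h2 : v • x - u • x' = u • (v • z - x') - v • (u • z - x) := by
      rw [smul_sub, smul_sub, smul_smul, smul_smul, mul_comm]; abel
    rw [h2]
    refine (norm_sub_le _ _).trans_lt ?_
    rw [norm_smul, norm_smul, hu, hv]
    linarith
  have h3 : ‖v • x - u • x'‖ ^ 2 =
      ‖v • x‖ ^ 2 - 2 * (inner ℂ (v • x) (u • x')).re + ‖u • x'‖ ^ 2 :=
    norm_sub_sq (𝕜 := ℂ) _ _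
  have h4 : (inner ℂ (v • x) (u • x')).re ≤ ‖inner ℂ x x'‖ := by
    refine (Complex.re_le_norm _).trans ?_
    rw [inner_smul_left, inner_smul_right, norm_mul, norm_mul, Complex.norm_conj, hu, hv]
    simp
  rw [norm_smul, norm_smul, hu, hv, hx, hx'] at h3
  nlinarith [norm_nonneg (v • x - u • x')]

/-! ### Sign vectors -/

/-- The sign `±1` encoded by a Boolean. -/
def boolSign (b : Bool) : ℝ := if b then 1 else -1

theorem boolSign_sq (b : Bool) : boolSign b ^ 2 = 1 := by cases b <;> norm_num [boolSign]

theorem sum_exp_sign_le {n : ℕ} (c : Fin n → ℝ) (hc : ∀ i, c i ^ 2 = 1) (t : ℝ) :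
    ∑ ε : Fin n → Bool, Real.exp (t * ∑ i, c i * boolSign (ε i)) ≤
      2 ^ n * Real.exp (n * t ^ 2 / 2) := by
  have h1 : ∀ ε : Fin n → Bool, Real.exp (t * ∑ i, c i * boolSign (ε i)) =
      ∏ i, Real.exp (t * (c i * boolSign (ε i))) := by
    intro ε; rw [Finset.mul_sum, Real.exp_sum]
  simp_rw [h1]
  rw [← Fintype.piFinset_univ,
    ← Finset.prod_univ_sum (fun _ => Finset.univ) fun i b => Real.exp (t * (c i * boolSign b))]
  have h2 : ∀ i, ∑ b, Real.exp (t * (c i * boolSign b)) ≤ 2 * Real.exp (t ^ 2 / 2) := by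
    intro i
    have h3 := Real.cosh_le_exp_half_sq (t * c i)
    rw [mul_pow, hc, mul_one, Real.cosh_eq] at h3
    simp only [Fintype.sum_bool, boolSign, if_true, Bool.false_eq_true, if_false]
    rw [mul_one, show t * (c i * -1) = -(t * c i) by ring]
    linarith
  refine (Finset.prod_le_prod (fun i _ => Finset.sum_nonneg fun _ _ => (Real.exp_pos _).le)
    fun i _ => h2 i).trans_eq ?_
  rw [Finset.prod_const, Finset.card_univ, Fintype.card_fin, mul_pow, ← Real.exp_nat_mul]
  congr 2
  ring

/-- Hoeffding's inequality for the number of sign patterns correlated with a given one. -/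
theorem card_sign_correlated_le {n : ℕ} (c : Fin n → ℝ) (hc : ∀ i, c i ^ 2 = 1)
    (T : Finset (Fin n → Bool)) (hT : ∀ ε ∈ T, (n : ℝ) / 2 ≤ |∑ i, c i * boolSign (ε i)|) :
    (T.card : ℝ) ≤ 2 ^ n * (2 * Real.exp (-(n / 8))) := by
  -- Chernoff with parameter ±1/2: the threshold n/2 contributes exp(n/4) against an exponential
  -- moment exp(n/8).
  have h1 : ∀ ε ∈ T, Real.exp (n / 4) ≤ Real.exp (1 / 2 * ∑ i, c i * boolSign (ε i)) +
      Real.exp (-(1 / 2) * ∑ i, c i * boolSign (ε i)) := by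
    intro ε hε
    rcases le_abs.1 (hT ε hε) with h | h
    · have := Real.exp_le_exp.2 (show (n : ℝ) / 4 ≤ 1 / 2 * ∑ i, c i * boolSign (ε i) by linarith)
      linarith [Real.exp_pos (-(1 / 2) * ∑ i, c i * boolSign (ε i))]
    · have := Real.exp_le_exp.2
        (show (n : ℝ) / 4 ≤ -(1 / 2) * ∑ i, c i * boolSign (ε i) by linarith)
      linarith [Real.exp_pos (1 / 2 * ∑ i, c i * boolSign (ε i))]
  have h2 : (T.card : ℝ) * Real.exp (n / 4) ≤ 2 ^ n * (2 * Real.exp (n / 8)) := by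
    calc (T.card : ℝ) * Real.exp (n / 4) = ∑ ε ∈ T, Real.exp (n / 4) := by simp
      _ ≤ _ := Finset.sum_le_sum h1
      _ ≤ _ := Finset.sum_le_univ_sum_of_nonneg fun _ => by positivity
      _ ≤ 2 ^ n * Real.exp (n * (1 / 2) ^ 2 / 2) + 2 ^ n * Real.exp (n * (-(1 / 2)) ^ 2 / 2) := by
        rw [Finset.sum_add_distrib]
        exact add_le_add (sum_exp_sign_le c hc _) (sum_exp_sign_le c hc _)
      _ = _ := by
        rw [show (n : ℝ) * (1 / 2) ^ 2 / 2 = n / 8 by ring,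
          show (n : ℝ) * (-(1 / 2)) ^ 2 / 2 = n / 8 by ring]
        ring
  have h3 : Real.exp ((n : ℝ) / 8) = Real.exp (-(n / 8)) * Real.exp (n / 4) := by
    rw [← Real.exp_add]; congr 1; ring
  rw [h3] at h2
  refine le_of_mul_le_mul_right (h2.trans_eq ?_) (Real.exp_pos (n / 4))
  ring

/-- The signal of norm `δ` whose coordinates are `± δ / √n`. -/
noncomputable def signVec {n : ℕ} (δ : ℝ) (ε : Fin n → Bool) : EuclideanSpace ℂ (Fin n) :=
  WithLp.toLp 2 fun i => ((δ / Real.sqrt n * boolSign (ε i) : ℝ) : ℂ)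

theorem inner_signVec {n : ℕ} (δ : ℝ) (ε ε' : Fin n → Bool) :
    inner ℂ (signVec δ ε) (signVec δ ε') =
      ((δ ^ 2 / n * ∑ i, boolSign (ε i) * boolSign (ε' i) : ℝ) : ℂ) := by
  simp only [PiLp.inner_apply, signVec, RCLike.inner_apply, Complex.conj_ofReal]
  rw [Finset.mul_sum, Complex.ofReal_sum]
  refine Finset.sum_congr rfl fun i _ => ?_
  rw [← Complex.ofReal_mul]
  congr 1
  have : δ ^ 2 / n = (δ / Real.sqrt n) ^ 2 := by
    rw [div_pow, Real.sq_sqrt (Nat.cast_nonneg n)]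
  rw [this]
  ring

theorem norm_signVec {n : ℕ} (hn : n ≠ 0) {δ : ℝ} (hδ : 0 ≤ δ) (ε : Fin n → Bool) :
    ‖signVec δ ε‖ = δ := by
  have h := inner_self_eq_norm_sq_to_K (𝕜 := ℂ) (signVec δ ε)
  rw [inner_signVec] at h
  simp only [← sq, boolSign_sq, Finset.sum_const, Finset.card_univ, Fintype.card_fin,
    nsmul_eq_mul, mul_one] at h
  rw [div_mul_cancel₀ _ (by exact_mod_cast hn)] at h
  have h' : δ ^ 2 = ‖signVec δ ε‖ ^ 2 := Complex.ofReal_injective (by simpa using h)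
  exact ((sq_eq_sq₀ hδ (norm_nonneg _)).1 h').symm

/-- Any one pattern in T serves as reference: all the others share the nearby point z with it, hence
have correlation at least n/2 with it in absolute value, and few sign patterns do. -/
theorem card_phaseDist_signVec_lt_le {n : ℕ} (hn : n ≠ 0) {δ : ℝ} (hδ : 0 < δ)
    (z : EuclideanSpace ℂ (Fin n)) (T : Finset (Fin n → Bool))
    (hT : ∀ ε ∈ T, phaseDist z (signVec δ ε) < δ / 2) :
    (T.card : ℝ) ≤ 2 ^ n * (2 * Real.exp (-(n / 8))) := by
  rcases T.eq_empty_or_nonempty with rfl | ⟨ε₀, hε₀⟩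
  · simp; positivity
  refine card_sign_correlated_le (fun i => boolSign (ε₀ i)) (fun i => boolSign_sq _) T
    fun ε hε => ?_
  have hN : ∀ ε : Fin n → Bool, ‖signVec δ ε‖ = 2 * (δ / 2) := fun ε => by
    rw [norm_signVec hn hδ.le]; ring
  have h := norm_inner_gt_of_phaseDist_lt (hT ε₀ hε₀) (hT ε hε) (hN _) (hN _)
  rw [inner_signVec, Complex.norm_real, Real.norm_eq_abs, abs_mul,
    abs_of_nonneg (by positivity : 0 ≤ δ ^ 2 / (n : ℝ))] at h
  have hn' : (0 : ℝ) < n := by positivity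
  have h2 : δ ^ 2 / n * (n / 2) < δ ^ 2 / n * |∑ i, boolSign (ε₀ i) * boolSign (ε i)| := by
    refine lt_of_eq_of_lt ?_ h
    field_simp
  exact (lt_of_mul_lt_mul_left h2 (by positivity)).le

/-! ### The lower bound for a fixed design -/

/-- Markov's inequality at level δ/2: the failure probability is below (δ/8)/(δ/2) = 1/4. -/
theorem noiseLaw_real_ge_of_risk_lt {n m : ℕ} {σ : ℝ} {δ : ℝ} (hδ : 0 < δ)
    (φ : Fin m → EuclideanSpace ℂ (Fin n)) {xhat : (Fin m → ℝ) → EuclideanSpace ℂ (Fin n)}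
    (hx : Measurable xhat) (x : EuclideanSpace ℂ (Fin n))
    (h : risk σ φ xhat x < ENNReal.ofReal (δ / 8)) :
    3 / 4 ≤ (noiseLaw m σ).real
      {ξ | phaseless φ x + ξ ∈ {y | phaseDist (xhat y) x < δ / 2}} := by
  have hmeas : Measurable fun ξ : Fin m → ℝ => phaseDist (xhat (phaseless φ x + ξ)) x :=
    (measurable_phaseDist x).comp (hx.comp (by fun_prop))
  have hB : MeasurableSet {ξ | phaseless φ x + ξ ∈ {y | phaseDist (xhat y) x < δ / 2}} :=
    measurableSet_lt hmeas measurable_const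
  have h1 := mul_meas_ge_le_lintegral (μ := noiseLaw m σ) hmeas.ennreal_ofReal
    (ENNReal.ofReal (δ / 2))
  have h2 := h1.trans_lt h
  have h3 : {ξ | ENNReal.ofReal (δ / 2) ≤
      ENNReal.ofReal (phaseDist (xhat (phaseless φ x + ξ)) x)} =
      {ξ | phaseless φ x + ξ ∈ {y | phaseDist (xhat y) x < δ / 2}}ᶜ := by
    ext ξ
    have hpos : 0 < δ / 2 := by positivity
    simp only [Set.mem_ofPred_eq, Set.mem_compl_iff, not_lt]
    exact ENNReal.ofReal_le_ofReal_iff' |>.trans ⟨fun h => h.resolve_right (not_le.2 hpos), Or.inl⟩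
  rw [h3, ← ofReal_measureReal, ← ENNReal.ofReal_mul (by positivity),
    ENNReal.ofReal_lt_ofReal_iff (by positivity), probReal_compl_eq_one_sub hB] at h2
  by_contra hlt
  rw [not_le] at hlt
  nlinarith

/-- The sum is the expected number of patterns that the estimate approximates, and the packing bound
holds for every y. The law here is pure noise, the same for all ε, which is what lets sum and
integral be exchanged. -/
theorem sum_noiseLaw_real_le {n m : ℕ} (hn : n ≠ 0) (σ : ℝ) {δ : ℝ} (hδ : 0 < δ)
    {xhat : (Fin m → ℝ) → EuclideanSpace ℂ (Fin n)} (hx : Measurable xhat) :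
    ∑ ε : Fin n → Bool, (noiseLaw m σ).real {y | phaseDist (xhat y) (signVec δ ε) < δ / 2} ≤
      2 ^ n * (2 * Real.exp (-(n / 8))) := by
  classical
  have hA : ∀ ε : Fin n → Bool, MeasurableSet {y | phaseDist (xhat y) (signVec δ ε) < δ / 2} :=
    fun ε => measurableSet_lt ((measurable_phaseDist _).comp hx) measurable_const
  have hI : ∀ ε : Fin n → Bool, Integrable
      ({y | phaseDist (xhat y) (signVec δ ε) < δ / 2}.indicator (1 : (Fin m → ℝ) → ℝ))
      (noiseLaw m σ) := fun ε => (integrable_const (1 : ℝ)).indicator (hA ε)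
  simp_rw [← fun ε => integral_indicator_one (μ := noiseLaw m σ) (hA ε)]
  rw [← integral_finsetSum _ fun ε _ => hI ε]
  have hb : ∀ y, ∑ ε : Fin n → Bool,
      ({y | phaseDist (xhat y) (signVec δ ε) < δ / 2}.indicator 1 y : ℝ) ≤
        2 ^ n * (2 * Real.exp (-(n / 8))) := by
    intro y
    refine le_of_eq_of_le ?_ (card_phaseDist_signVec_lt_le hn hδ (xhat y)
      (Finset.univ.filter fun ε => phaseDist (xhat y) (signVec δ ε) < δ / 2) fun ε hε => by
        simpa using hε)
    rw [Finset.card_filter, Nat.cast_sum]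
    refine Finset.sum_congr rfl fun ε _ => ?_
    simp [Set.indicator_apply]
  refine (integral_mono (integrable_finsetSum _ fun ε _ => hI ε)
    (integrable_const _) hb).trans_eq ?_
  simp

theorem le_minimaxRisk_of_sum_le {n m : ℕ} (hn : 64 ≤ n) {σ δ : ℝ} (hσ : 0 < σ) (hδ : 0 < δ)
    (φ : Fin m → EuclideanSpace ℂ (Fin n))
    (hφ : ∑ ε : Fin n → Bool, ∑ k, ‖inner ℂ (φ k) (signVec δ ε)‖ ^ 4 ≤
      2 ^ n * (n * σ ^ 2 / 32)) :
    ENNReal.ofReal (δ / 8) ≤ minimaxRisk σ φ := by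
  refine le_iInf₂ fun xhat hx => ?_
  by_contra hcon
  rw [not_le] at hcon
  set S : (Fin n → Bool) → ℝ := fun ε => ∑ k, ‖inner ℂ (φ k) (signVec δ ε)‖ ^ 4 with hS
  set q : (Fin n → Bool) → ℝ := fun ε =>
    (noiseLaw m σ).real {y | phaseDist (xhat y) (signVec δ ε) < δ / 2} with hq
  have hn' : (64 : ℝ) ≤ n := by exact_mod_cast hn
  have h1 : ∀ ε, 9 / 16 ≤ Real.exp (S ε / σ ^ 2) * q ε := by
    intro ε
    have hr : risk σ φ xhat (signVec δ ε) < ENNReal.ofReal (δ / 8) :=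
      (le_iSup (fun x => risk σ φ xhat x) _).trans_lt hcon
    have hp := noiseLaw_real_ge_of_risk_lt hδ φ hx _ hr
    have hA : MeasurableSet {y | phaseDist (xhat y) (signVec δ ε) < δ / 2} :=
      measurableSet_lt ((measurable_phaseDist _).comp hx) measurable_const
    have hcs := noiseLaw_shift_sq_le hσ (phaseless φ (signVec δ ε)) hA
    rw [← ofReal_measureReal, ← ofReal_measureReal, ← ENNReal.ofReal_pow measureReal_nonneg,
      ← ENNReal.ofReal_mul (Real.exp_pos _).le, ENNReal.ofReal_le_ofReal_iff (by positivity)] at hcs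
    have hsum : ∑ k, phaseless φ (signVec δ ε) k ^ 2 = S ε :=
      Finset.sum_congr rfl fun k _ => by simp only [phaseless]; ring
    rw [hsum] at hcs
    nlinarith
  -- Only the average of S is controlled, so exp(-s) is replaced by its tangent line at s = n/32.
  -- Summing over ε is then linear in S, which amounts to Jensen's inequality.
  have h2 : ∀ ε, 9 / 16 * (Real.exp (-(n / 32 : ℝ)) * (1 + n / 32 - S ε / σ ^ 2)) ≤ q ε := by
    intro ε
    have h3 := Real.add_one_le_exp ((n : ℝ) / 32 - S ε / σ ^ 2)
    have h4 : Real.exp (-(n / 32 : ℝ)) * (1 + n / 32 - S ε / σ ^ 2) ≤ Real.exp (-(S ε / σ ^ 2)) := by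
      have : Real.exp (-(S ε / σ ^ 2)) =
          Real.exp (-(n / 32 : ℝ)) * Real.exp ((n : ℝ) / 32 - S ε / σ ^ 2) := by
        rw [← Real.exp_add]; congr 1; ring
      rw [this]
      exact mul_le_mul_of_nonneg_left (by linarith) (Real.exp_pos _).le
    have h5 : 9 / 16 * Real.exp (-(S ε / σ ^ 2)) ≤ q ε := by
      rw [Real.exp_neg, ← div_eq_mul_inv, div_le_iff₀ (Real.exp_pos _), mul_comm]
      exact h1 ε
    linarith
  have h6 := (Finset.sum_le_sum fun ε (_ : ε ∈ Finset.univ) => h2 ε).trans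
    (sum_noiseLaw_real_le (by omega) σ hδ hx)
  have h7 : ∑ ε, (1 + (n : ℝ) / 32 - S ε / σ ^ 2) ≥ 2 ^ n := by
    rw [Finset.sum_sub_distrib, ← Finset.sum_div]
    have : (∑ ε, S ε) / σ ^ 2 ≤ 2 ^ n * (n / 32) := by
      rw [div_le_iff₀ (by positivity)]
      linarith
    simp only [Finset.sum_const, Finset.card_univ, Fintype.card_fun, Fintype.card_bool,
      Fintype.card_fin, nsmul_eq_mul]
    push_cast
    linarith
  rw [← Finset.mul_sum, ← Finset.mul_sum] at h6
  have h8 : (2 : ℝ) ^ n * (9 / 16 * Real.exp (-(n / 32 : ℝ))) ≤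
      2 ^ n * (2 * Real.exp (-(n / 8 : ℝ))) := by
    refine le_trans ?_ h6
    have := mul_le_mul_of_nonneg_left h7 (Real.exp_pos (-(n / 32 : ℝ))).le
    linarith
  have h9 := le_of_mul_le_mul_left h8 (by positivity)
  have h10 : Real.exp (-(n / 32 : ℝ)) = Real.exp (-(n / 8 : ℝ)) * Real.exp (3 * n / 32) := by
    rw [← Real.exp_add]; congr 1; ring
  -- For n ≥ 64 this gives exp(3n/32) ≥ 7, and 7 · 9/16 > 2 contradicts `h9`.
  have h11 := Real.add_one_le_exp (3 * (n : ℝ) / 32)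
  rw [h10] at h9
  nlinarith [Real.exp_pos (-(n / 8 : ℝ))]

/-! ### The design is good with high probability -/

theorem lintegral_inner_pow_four_le {n : ℕ} (x : EuclideanSpace ℂ (Fin n)) :
    ∫⁻ φ, ENNReal.ofReal (‖inner ℂ φ x‖ ^ 4) ∂(complexGaussianVec n) ≤
      ENNReal.ofReal (400 * ‖x‖ ^ 4) := by
  by_cases hx : x = 0
  · simp [hx]
  have hx' : ‖x‖ ≠ 0 := norm_ne_zero_iff.2 hx
  set u : EuclideanSpace ℂ (Fin n) := ((‖x‖⁻¹ : ℝ) : ℂ) • x with hu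
  have hu1 : ‖u‖ = 1 := by
    rw [hu, norm_smul, Complex.norm_real, norm_inv, norm_norm, inv_mul_cancel₀ hx']
  have hxu : x = ((‖x‖ : ℝ) : ℂ) • u := by
    rw [hu, smul_smul, ← Complex.ofReal_mul, mul_inv_cancel₀ hx', Complex.ofReal_one, one_smul]
  have h : ∀ φ : EuclideanSpace ℂ (Fin n), ENNReal.ofReal (‖inner ℂ φ x‖ ^ 4) =
      ENNReal.ofReal (‖x‖ ^ 4) * ENNReal.ofReal (‖inner ℂ φ u‖ ^ 4) := by
    intro φ
    rw [← ENNReal.ofReal_mul (by positivity), ← mul_pow]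
    conv_lhs => rw [hxu, inner_smul_right, norm_mul, Complex.norm_real, norm_norm]
  simp_rw [h]
  rw [lintegral_const_mul _ (by fun_prop), mul_comm 400, ENNReal.ofReal_mul (by positivity)]
  gcongr
  simpa using lintegral_inner_pow_four_le_of_norm_one u hu1

theorem designLaw_compl_le {n m : ℕ} (hn : 64 ≤ n) {σ δ : ℝ} (hσ : 0 < σ) (hδ : 0 < δ) :
    designLaw n m {φ | ENNReal.ofReal (δ / 8) ≤ minimaxRisk σ φ}ᶜ ≤
      ENNReal.ofReal (12800 * m * δ ^ 4 / (n * σ ^ 2)) := by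
  have hn' : (64 : ℝ) ≤ n := by exact_mod_cast hn
  set K : ℝ := 2 ^ n * (n * σ ^ 2 / 32) with hK
  have hKpos : 0 < K := by positivity
  set F : (Fin m → EuclideanSpace ℂ (Fin n)) → ℝ≥0∞ := fun φ =>
    ∑ ε : Fin n → Bool, ∑ k, ENNReal.ofReal (‖inner ℂ (φ k) (signVec δ ε)‖ ^ 4) with hF
  have hFm : Measurable F := by fun_prop
  -- Enclosing the failure event in a superlevel set of the measurable `F` avoids any measurability
  -- question about the minimax risk.
  have hsub : {φ : Fin m → EuclideanSpace ℂ (Fin n) |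
      ENNReal.ofReal (δ / 8) ≤ minimaxRisk σ φ}ᶜ ⊆ {φ | ENNReal.ofReal K ≤ F φ} := by
    intro φ hφ
    simp only [Set.mem_compl_iff, Set.mem_ofPred_eq] at hφ ⊢
    by_contra hlt
    refine hφ (le_minimaxRisk_of_sum_le hn hσ hδ φ ?_)
    have : F φ = ENNReal.ofReal
        (∑ ε : Fin n → Bool, ∑ k, ‖inner ℂ (φ k) (signVec δ ε)‖ ^ 4) := by
      rw [ENNReal.ofReal_sum_of_nonneg fun _ _ => Finset.sum_nonneg fun _ _ => by positivity]
      exact Finset.sum_congr rfl fun ε _ =>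
        (ENNReal.ofReal_sum_of_nonneg fun _ _ => by positivity).symm
    rw [this, not_le, ENNReal.ofReal_lt_ofReal_iff hKpos] at hlt
    exact hlt.le
  have hint : ∫⁻ φ, F φ ∂(designLaw n m) ≤ ENNReal.ofReal (2 ^ n * (m * (400 * δ ^ 4))) := by
    rw [hF, lintegral_finsetSum _ fun ε _ => by fun_prop]
    calc _ ≤ ∑ ε : Fin n → Bool, ∑ k : Fin m, ENNReal.ofReal (400 * δ ^ 4) := by
          refine Finset.sum_le_sum fun ε _ => ?_
          rw [lintegral_finsetSum _ fun k _ => by fun_prop]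
          refine Finset.sum_le_sum fun k _ => ?_
          rw [lintegral_designLaw_eval k (f := fun v =>
            ENNReal.ofReal (‖inner ℂ v (signVec δ ε)‖ ^ 4)) (by fun_prop)]
          refine (lintegral_inner_pow_four_le _).trans_eq ?_
          rw [norm_signVec (by omega) hδ.le]
      _ = _ := by
          simp only [Finset.sum_const, Finset.card_univ, Fintype.card_fun, Fintype.card_bool,
            Fintype.card_fin, nsmul_eq_mul]
          rw [ENNReal.ofReal_mul (by positivity), ENNReal.ofReal_mul (by positivity)]
          simp [ENNReal.ofReal_pow]
  refine (measure_mono hsub).trans ((meas_ge_le_lintegral_div hFm.aemeasurable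
    (by simpa using hKpos) ENNReal.ofReal_ne_top).trans ?_)
  refine (ENNReal.div_le_div_right hint _).trans ?_
  rw [← ENNReal.ofReal_div_of_pos hKpos]
  refine ENNReal.ofReal_le_ofReal (le_of_eq ?_)
  rw [hK]
  field_simp
  ring

/-- The critical radius `√σ (n / m)^{1/4} / log^{1/4} m`. -/
noncomputable def criticalRadius (n m : ℕ) (σ : ℝ) : ℝ :=
  Real.sqrt σ * (((n : ℝ) / (m : ℝ)) ^ (1 / 4 : ℝ) / Real.log m ^ (1 / 4 : ℝ))

theorem rpow_quarter_pow_four {a : ℝ} (ha : 0 ≤ a) : (a ^ (1 / 4 : ℝ)) ^ 4 = a := by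
  rw [← Real.rpow_natCast, ← Real.rpow_mul ha]; norm_num

theorem withProbTendstoOne_criticalRadius {n m : ℕ → ℕ} {σ : ℕ → ℝ} (hn : Tendsto n atTop atTop)
    (hm : Tendsto m atTop atTop) (hσ : ∀ j, 0 < σ j) :
    WithProbTendstoOne (fun j => designLaw (n j) (m j)) (fun j =>
      {φ | ENNReal.ofReal (criticalRadius (n j) (m j) (σ j) / 8) ≤ minimaxRisk (σ j) φ}) := by
  have hlog : Tendsto (fun j => 12800 / Real.log (m j)) atTop (𝓝 0) :=
    tendsto_const_nhds.div_atTop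
      (Real.tendsto_log_atTop.comp (tendsto_natCast_atTop_atTop.comp hm))
  have hlim := ENNReal.tendsto_ofReal hlog
  rw [ENNReal.ofReal_zero] at hlim
  refine tendsto_of_tendsto_of_tendsto_of_le_of_le' tendsto_const_nhds hlim
    (Eventually.of_forall fun _ => zero_le) ?_
  filter_upwards [hn.eventually_ge_atTop 64, hm.eventually_ge_atTop 2] with j hnj hmj
  have hσj := hσ j
  have hn0 : (0 : ℝ) < n j := by exact_mod_cast (by omega : 0 < n j)
  have hm0 : (1 : ℝ) < m j := by exact_mod_cast (by omega : 1 < m j)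
  have hl : 0 < Real.log (m j) := Real.log_pos hm0
  have hm1 : (0 : ℝ) < m j := by linarith
  have hδ : 0 < criticalRadius (n j) (m j) (σ j) := by unfold criticalRadius; positivity
  refine (designLaw_compl_le hnj hσj hδ).trans (ENNReal.ofReal_le_ofReal (le_of_eq ?_))
  have h4 : criticalRadius (n j) (m j) (σ j) ^ 4 =
      σ j ^ 2 * ((n j : ℝ) / m j / Real.log (m j)) := by
    rw [criticalRadius, mul_pow, div_pow, rpow_quarter_pow_four (by positivity),
      rpow_quarter_pow_four hl.le, show Real.sqrt (σ j) ^ 4 = (Real.sqrt (σ j) ^ 2) ^ 2 by ring,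
      Real.sq_sqrt hσj.le]
  rw [h4]
  field_simp

/-- Dropping the nonnegative term in t from the denominator leaves exactly the critical radius, so a
single bound covers signals of every norm. -/
theorem rate_le_criticalRadius {n m : ℕ} {σ t : ℝ} (hn : 0 < n) (hm : 1 < m) (hσ : 0 < σ)
    (ht : 0 ≤ t) :
    Real.sqrt ((n : ℝ) / m) / (t * Real.sqrt (Real.log m) / σ
      + (Real.log m / σ ^ 2) ^ (1 / 4 : ℝ) * ((n : ℝ) / m) ^ (1 / 4 : ℝ)) ≤
        criticalRadius n m σ := by
  have hm' : (1 : ℝ) < m := by exact_mod_cast hm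
  have hl : 0 < Real.log m := Real.log_pos hm'
  have hm0 : (0 : ℝ) < m := by linarith
  have hn0 : (0 : ℝ) < n := by exact_mod_cast hn
  have ha : (0 : ℝ) < (n : ℝ) / m := by positivity
  have hpos : 0 < (Real.log m / σ ^ 2) ^ (1 / 4 : ℝ) * ((n : ℝ) / m) ^ (1 / 4 : ℝ) := by
    positivity
  have h1 : Real.sqrt ((n : ℝ) / m) =
      ((n : ℝ) / m) ^ (1 / 4 : ℝ) * ((n : ℝ) / m) ^ (1 / 4 : ℝ) := by
    rw [← Real.rpow_add ha, Real.sqrt_eq_rpow]; norm_num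
  have h2 : (Real.log m / σ ^ 2) ^ (1 / 4 : ℝ) = Real.log m ^ (1 / 4 : ℝ) / Real.sqrt σ := by
    rw [Real.div_rpow hl.le (sq_nonneg _), ← Real.rpow_natCast, ← Real.rpow_mul hσ.le,
      Real.sqrt_eq_rpow]
    norm_num
  calc _ ≤ Real.sqrt ((n : ℝ) / m) /
        ((Real.log m / σ ^ 2) ^ (1 / 4 : ℝ) * ((n : ℝ) / m) ^ (1 / 4 : ℝ)) := by
        refine div_le_div_of_nonneg_left (Real.sqrt_nonneg _) hpos ?_
        have : 0 ≤ t * Real.sqrt (Real.log m) / σ := by positivity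
        linarith
    _ = criticalRadius n m σ := by
        rw [h1, h2, criticalRadius]
        have : 0 < Real.log m ^ (1 / 4 : ℝ) := by positivity
        have : 0 < Real.sqrt σ := by positivity
        have : 0 < ((n : ℝ) / m) ^ (1 / 4 : ℝ) := by positivity
        field_simp

theorem WithProbTendstoOne.mono {Ω : ℕ → Type*} [∀ j, MeasurableSpace (Ω j)]
    {P : ∀ j, Measure (Ω j)} {A B : ∀ j, Set (Ω j)} (hA : WithProbTendstoOne P A)
    (h : ∀ᶠ j in atTop, A j ⊆ B j) : WithProbTendstoOne P B :=
  tendsto_of_tendsto_of_tendsto_of_le_of_le' tendsto_const_nhds hA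
    (Eventually.of_forall fun _ => zero_le)
    (h.mono fun _ hj => measure_mono (Set.compl_subset_compl.2 hj))

end PhaseRetrieval

theorem theorem5 :
    ∃ L C₁ C₂ : ℝ, 0 < L ∧ 0 < C₁ ∧ 0 < C₂ ∧
      ∀ (n m : ℕ → ℕ) (σ : ℕ → ℝ),
        Tendsto n atTop atTop → Tendsto m atTop atTop →
        (∀ᶠ j in atTop, L * (n j : ℝ) ≤ (m j : ℝ)) → (∀ j, 0 < σ j) →
        -- part (a)
        PhaseRetrieval.WithProbTendstoOne (fun j => PhaseRetrieval.designLaw (n j) (m j))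
          (fun j => {φ | ∀ x : EuclideanSpace ℂ (Fin (n j)), x ≠ 0 →
            ENNReal.ofReal (C₁ * min ‖x‖
              (Real.sqrt ((n j : ℝ) / (m j : ℝ)) /
                (‖x‖ * Real.sqrt (Real.log (m j)) / σ j
                  + (Real.log (m j) / σ j ^ 2) ^ (1 / 4 : ℝ)
                    * ((n j : ℝ) / (m j : ℝ)) ^ (1 / 4 : ℝ))))
              ≤ PhaseRetrieval.minimaxRisk (σ j) φ}) ∧
        -- part (b)
        ∀ x : (j : ℕ) → EuclideanSpace ℂ (Fin (n j)), (∀ᶠ j in atTop, x j ≠ 0) →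
          (fun j => ‖x j‖) =o[atTop]
            (fun j => Real.sqrt (σ j) *
              (((n j : ℝ) / (m j : ℝ)) ^ (1 / 4 : ℝ) / Real.log (m j) ^ (1 / 4 : ℝ))) →
          PhaseRetrieval.WithProbTendstoOne (fun j => PhaseRetrieval.designLaw (n j) (m j))
            (fun j => {φ |
              ENNReal.ofReal (C₂ * (Real.sqrt (σ j) *
                (((n j : ℝ) / (m j : ℝ)) ^ (1 / 4 : ℝ) / Real.log (m j) ^ (1 / 4 : ℝ))))
                ≤ PhaseRetrieval.minimaxRisk (σ j) φ}) := by
  -- Both constants 1/8 are the risk level δ/8 at the critical radius.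
  refine ⟨1, 1 / 8, 1 / 8, one_pos, by norm_num, by norm_num, fun n m σ hn hm _ hσ => ⟨?_, ?_⟩⟩
  · refine (PhaseRetrieval.withProbTendstoOne_criticalRadius hn hm hσ).mono ?_
    filter_upwards [hn.eventually_gt_atTop 0, hm.eventually_gt_atTop 1] with j hnj hmj φ hφ x _
    refine (ENNReal.ofReal_le_ofReal ?_).trans hφ
    have h := (min_le_right ‖x‖ _).trans
      (PhaseRetrieval.rate_le_criticalRadius hnj hmj (hσ j) (norm_nonneg x))
    linarith
  · intro x _ _
    refine (PhaseRetrieval.withProbTendstoOne_criticalRadius hn hm hσ).mono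
      (Eventually.of_forall fun j φ hφ => ?_)
    rwa [one_div_mul_eq_div]
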